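/- A 4-spectrum is a list of four complex numbers, repetitions allowed. A list $\sigma$ is realizable if it is the list of eigenvalues (with algebraic multiplicity) of an entrywise nonnegative matrix, and irreducibly realizable if it is the list of eigenvalues of an irreducible entrywise nonnegative matrix, that is, one that is not similar by a permutation matrix to a nontrivially block triangular matrix. Let $\rho(\sigma)$ be the largest absolute value of an element of $\sigma$. The list $\sigma$ is spectrally simple if $\rho(\sigma)$ is, counting multiplicity, the only element of $\sigma$ on the circle $|z|=\rho(\sigma)$. A list $\sigma$ that is not spectrally simple, is closed under complex conjugation (with multiplicity), has nonnegative sum and contains $\rho=\rho(\sigma)$ has Frobenius structure if $\rho>0$ and, for some integers $h>1$, $p\ge 0$, $m\ge 1$ and nonzero complex numbers $z_2,\dots,z_m$ with $|z_j|<1$, $$\prod_{\lambda\in\sigma}(x-\lambda)=x^p\,(x^h-\rho^h)\,(x^h-(z_2\rho)^h)\cdots(x^h-(z_m\rho)^h).$$ Theorem. Let $\sigma$ be a realizable list of four real numbers. Then exactly one of the following holds: (i) $\sigma$ is irreducibly realizable; (ii) $\sigma$ is not spectrally simple and does not have Frobenius structure. -/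

import Mathlib

namespace NIEP

open Polynomial

/-- The list of eigenvalues of a real square matrix, as a multiset of complex numbers
(repetitions according to algebraic multiplicity). -/
noncomputable def matrixSpectrum {n : ℕ} (A : Matrix (Fin n) (Fin n) ℝ) : Multiset ℂ :=
  (A.map (algebraMap ℝ ℂ)).charpoly.roots

/-- `A` is reducible: permuting rows and columns simultaneously makes it block triangular with
two nonempty square diagonal blocks, of sizes `k` and `n - k`. -/
def IsReducible {n : ℕ} (A : Matrix (Fin n) (Fin n) ℝ) : Prop :=
  ∃ (π : Equiv.Perm (Fin n)) (k : ℕ), 0 < k ∧ k < n ∧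
    ∀ i j : Fin n, k ≤ (i : ℕ) → (j : ℕ) < k → A (π i) (π j) = 0

/-- `σ` is the spectrum of an entrywise nonnegative matrix.
(The size of the matrix is necessarily the number of elements of `σ`.) -/
def IsRealizable (σ : Multiset ℂ) : Prop :=
  ∃ (n : ℕ) (A : Matrix (Fin n) (Fin n) ℝ), (∀ i j, 0 ≤ A i j) ∧ matrixSpectrum A = σ

/-- `σ` is the spectrum of an irreducible entrywise nonnegative matrix. -/
def IsIrreduciblyRealizable (σ : Multiset ℂ) : Prop :=
  ∃ (n : ℕ) (A : Matrix (Fin n) (Fin n) ℝ),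
    (∀ i j, 0 ≤ A i j) ∧ ¬ IsReducible A ∧ matrixSpectrum A = σ

/-- `ρ(σ)`: the largest absolute value of an element of `σ`. -/
noncomputable def perronRoot (σ : Multiset ℂ) : ℝ :=
  ((σ.map (fun z => ‖z‖₊)).sup : NNReal)

/-- `σ` is spectrally simple: `ρ(σ)` is the only element of `σ`, counted with multiplicity,
on the circle of radius `ρ(σ)`. -/
noncomputable def IsSpectrallySimple (σ : Multiset ℂ) : Prop :=
  σ.filter (fun z => ‖z‖ = perronRoot σ) = {(perronRoot σ : ℂ)}

/-- `σ` has Frobenius structure: it satisfies the trace, reality and Perron conditions, is not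
spectrally simple, `ρ = ρ(σ)` is positive, and for some `h > 1` the monic polynomial with list of
roots `σ` is `x ^ p * (x ^ h - ρ ^ h) * (x ^ h - (z₂ ρ) ^ h) * ⋯ * (x ^ h - (z_m ρ) ^ h)`
with `0 < |z_j| < 1`; here `Z` is the list `z₂, …, z_m`, possibly empty. -/
noncomputable def HasFrobeniusStructure (σ : Multiset ℂ) : Prop :=
  0 ≤ σ.sum.re ∧
  σ.map (starRingEnd ℂ) = σ ∧
  (perronRoot σ : ℂ) ∈ σ ∧
  ¬ IsSpectrallySimple σ ∧
  0 < perronRoot σ ∧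
  ∃ (h p : ℕ) (Z : Multiset ℂ), 1 < h ∧ (∀ z ∈ Z, z ≠ 0 ∧ ‖z‖ < 1) ∧
    (σ.map (fun z => X - C z)).prod =
      X ^ p * (X ^ h - C ((perronRoot σ : ℂ) ^ h)) *
        (Z.map (fun z => X ^ h - C ((z * (perronRoot σ : ℂ)) ^ h))).prod

end NIEP

/-! The claim says that a realizable real list of length four is irreducibly realizable exactly when
it is spectrally simple or has Frobenius structure.

Necessity is Perron–Frobenius (`perronRoot_of_isIrreduciblyRealizable`): ρ is a simple root, and if
-ρ also occurs, the trace is zero. A real number of modulus ρ is ±ρ. So either the list is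
spectrally simple, or it is ρ, -ρ, a, -a, with polynomial (x² - ρ²)(x² - a²), which is Frobenius
structure with h = 2.

Sufficiency is by explicit matrices. For a spectrally simple list, nonnegativity of the sum is all
that is needed of realizability (`isIrreduciblyRealizable_of_lt`). Frobenius structure forces sum
zero and ρ simple, hence again the form ρ, -ρ, a, -a, realized by a weighted 4-cycle. -/

namespace NIEP

open Matrix Polynomial

/-! ### Perron–Frobenius theory for irreducible real matrices -/

section PerronFrobenius

variable {m : Type*}

/-- Every nonempty proper set of indices has an arc of the digraph of `A` leaving it. -/
def HasNoClosedSet (A : Matrix m m ℝ) : Prop :=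
  ∀ S : Set m, S.Nonempty → Sᶜ.Nonempty → ∃ i ∈ S, ∃ j ∉ S, A i j ≠ 0

lemma HasNoClosedSet.transpose {A : Matrix m m ℝ} (hA : HasNoClosedSet A) :
    HasNoClosedSet Aᵀ := by
  intro S hS hS'
  obtain ⟨i, hi, j, hj, h⟩ := hA Sᶜ hS' (by simpa using hS)
  exact ⟨j, by simpa using hj, i, hi, h⟩

/-- If no arc leaves S, a permutation listing the complement of S first makes the matrix block
triangular. -/
lemma hasNoClosedSet_of_not_isReducible {n : ℕ} {A : Matrix (Fin n) (Fin n) ℝ}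
    (hA : ¬ IsReducible A) : HasNoClosedSet A := by
  classical
  intro S hS hS'
  by_contra! h
  apply hA
  obtain ⟨a, ha⟩ := hS
  obtain ⟨b, hb⟩ := hS'
  let T : Finset (Fin n) := {i | i ∉ S}
  have hT : T.card ≤ n := by simpa using Finset.card_le_univ T
  have hcard : Fintype.card {i : Fin n // (i : ℕ) < T.card} = Fintype.card {i : Fin n // i ∉ S} := by
    rw [Fintype.card_subtype, Fintype.card_subtype]
    exact (Fin.card_filter_val_lt (n := n) (m := T.card)).trans (by rw [min_eq_right hT])
  let e := Fintype.equivOfCardEq hcard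
  refine ⟨e.extendSubtype, T.card, Finset.card_pos.2 ⟨b, by simpa [T] using hb⟩, ?_, ?_⟩
  · have : T ⊂ Finset.univ := by
      refine (Finset.ssubset_univ_iff).2 fun hu => ?_
      have : a ∈ T := hu ▸ Finset.mem_univ a
      simp [T, ha] at this
    simpa using Finset.card_lt_card this
  · intro i j hi hj
    refine h _ ?_ _ (e.extendSubtype_mem j hj)
    simpa using e.extendSubtype_not_mem i (by simpa using hi)

lemma not_isReducible_of_hasNoClosedSet {n : ℕ} {A : Matrix (Fin n) (Fin n) ℝ}
    (hA : HasNoClosedSet A) : ¬ IsReducible A := by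
  rintro ⟨π, k, hk, hkn, h⟩
  obtain ⟨i, hi, j, hj, hij⟩ := hA {i | k ≤ (π.symm i : ℕ)}
    ⟨π ⟨k, hkn⟩, by simp⟩ ⟨π ⟨0, by omega⟩, by simpa using hk.ne'⟩
  have := h (π.symm i) (π.symm j) hi (by simpa using hj)
  simp at this
  exact hij this

variable [Fintype m]

lemma mulVec_apply_nonneg {A : Matrix m m ℝ} (hA : ∀ i j, 0 ≤ A i j) {x : m → ℝ} (hx : ∀ i, 0 ≤ x i)
    (i : m) : 0 ≤ (A *ᵥ x) i :=
  Finset.sum_nonneg fun j _ => mul_nonneg (hA i j) (hx j)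

lemma mulVec_pos_of_entry {A : Matrix m m ℝ} (hA : ∀ i j, 0 ≤ A i j) {x : m → ℝ}
    (hx : ∀ i, 0 ≤ x i) {i j : m} (hij : A i j ≠ 0) (hj : x j ≠ 0) : 0 < (A *ᵥ x) i :=
  Finset.sum_pos' (fun j _ => mul_nonneg (hA i j) (hx j))
    ⟨j, Finset.mem_univ j, mul_pos ((hA i j).lt_of_ne' hij) ((hx j).lt_of_ne' hj)⟩

/-- A nonnegative subinvariant vector of an irreducible matrix is zero or positive. -/
lemma pos_of_mulVec_le {A : Matrix m m ℝ} (hA : ∀ i j, 0 ≤ A i j) (hirr : HasNoClosedSet A)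
    {x : m → ℝ} (hx : ∀ i, 0 ≤ x i) (hx0 : x ≠ 0) {c : ℝ} (h : ∀ i, (A *ᵥ x) i ≤ c * x i) (i : m) :
    0 < x i := by
  by_contra! hi
  obtain ⟨k, hk⟩ := Function.ne_iff.1 hx0
  obtain ⟨a, ha, b, hb, hab⟩ := hirr {i | x i = 0} ⟨i, le_antisymm hi (hx i)⟩ ⟨k, hk⟩
  have h1 := mulVec_pos_of_entry hA hx hab hb
  have h2 := h a
  rw [show x a = 0 from ha, mul_zero] at h2
  linarith

/-- Some power of `1 + A` makes a nonzero nonnegative vector positive. -/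
lemma exists_one_add_pow_mulVec_pos [DecidableEq m] {A : Matrix m m ℝ} (hA : ∀ i j, 0 ≤ A i j)
    (hirr : HasNoClosedSet A) :
    ∃ N : ℕ, ∀ x : m → ℝ, (∀ i, 0 ≤ x i) → x ≠ 0 → ∀ i, 0 < (((1 + A) ^ N) *ᵥ x) i := by
  classical
  suffices H : ∀ N : ℕ, ∀ x : m → ℝ, (∀ i, 0 ≤ x i) → x ≠ 0 →
      (Finset.univ.filter fun i => x i = 0).card ≤ N → ∀ i, 0 < (((1 + A) ^ N) *ᵥ x) i from
    ⟨Fintype.card m, fun x hx hx0 => H _ x hx hx0 (Finset.card_le_univ _)⟩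
  intro N
  induction N with
  | zero =>
    intro x hx hx0 hc i
    have : x i ≠ 0 := fun hi => by
      have := Finset.card_pos.2 ⟨i, by simpa using hi⟩ |>.trans_le hc
      omega
    simpa using (hx i).lt_of_ne' this
  | succ N ih =>
    intro x hx hx0 hc
    have hy : ∀ i, ((1 + A) *ᵥ x) i = x i + (A *ᵥ x) i := fun i => by
      simp [Matrix.add_mulVec]
    have hAx := mulVec_apply_nonneg hA hx
    have hle : ∀ i, x i ≤ ((1 + A) *ᵥ x) i := fun i => by rw [hy]; linarith [hAx i]
    rw [pow_succ, ← Matrix.mulVec_mulVec]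
    obtain ⟨k, hk⟩ := Function.ne_iff.1 hx0
    refine ih _ (fun i => (hx i).trans (hle i)) ?_ ?_
    · intro h0
      have := hle k
      rw [h0] at this
      exact hk (le_antisymm this (hx k))
    -- Applying 1 + A keeps positive entries positive. An arc leaving the zero set makes at least
    -- one zero entry positive, so the number of zeros drops.
    · by_cases hne : ∃ i, x i = 0
      · obtain ⟨a, ha, b, hb, hab⟩ := hirr {i | x i = 0} hne ⟨k, hk⟩
        refine Nat.le_of_lt_succ (lt_of_lt_of_le (Finset.card_lt_card ?_) hc)
        refine (Finset.ssubset_iff_of_subset fun i hi => ?_).2 ⟨a, by simpa using ha, ?_⟩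
        · simp only [Finset.mem_filter, Finset.mem_univ, true_and] at hi ⊢
          exact le_antisymm (hi ▸ hle i) (hx i)
        · simp only [Finset.mem_filter, Finset.mem_univ, true_and, hy]
          have := mulVec_pos_of_entry hA hx hab hb
          have := hx a
          positivity
      · push Not at hne
        rw [Finset.filter_false_of_mem]
        · simp
        · intro i _
          exact (((hx i).lt_of_ne' (hne i)).trans_le (hle i)).ne'

/-- Existence of the Perron vector, by maximising the Collatz–Wielandt quotient. -/
lemma exists_perron_vector [Nonempty m] {A : Matrix m m ℝ} (hA : ∀ i j, 0 ≤ A i j)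
    (hirr : HasNoClosedSet A) :
    ∃ (r : ℝ) (x : m → ℝ), 0 ≤ r ∧ (∀ i, 0 < x i) ∧ A *ᵥ x = r • x := by
  classical
  obtain ⟨N, hN⟩ := exists_one_add_pow_mulVec_pos hA hirr
  -- Summing t * x i ≤ (A x) i over a simplex vector gives t ≤ M, so bounding the quotient by M
  -- loses nothing and makes K compact.
  set M : ℝ := ∑ i, ∑ j, A i j
  let K : Set (ℝ × (m → ℝ)) :=
    (Set.Icc 0 M ×ˢ stdSimplex ℝ m) ∩ {p | ∀ i, p.1 * p.2 i ≤ (A *ᵥ p.2) i}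
  have hK : IsCompact K := by
    refine (isCompact_Icc.prod (isCompact_stdSimplex ℝ m)).inter_right ?_
    simp only [Set.ofPred_forall]
    refine isClosed_iInter fun i => isClosed_le (by fun_prop) ?_
    simp only [Matrix.mulVec, dotProduct]
    fun_prop
  have hM : 0 ≤ M := Finset.sum_nonneg fun i _ => Finset.sum_nonneg fun j _ => hA i j
  have hKne : K.Nonempty := by
    obtain ⟨i⟩ := ‹Nonempty m›
    refine ⟨(0, Pi.single i 1), ⟨⟨le_rfl, hM⟩, single_mem_stdSimplex ℝ i⟩, fun j => ?_⟩
    rw [zero_mul]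
    exact mulVec_apply_nonneg hA (single_mem_stdSimplex ℝ i).1 j
  obtain ⟨⟨r, x⟩, ⟨⟨⟨hr0, hrM⟩, hx⟩, hrx⟩, hmax⟩ :=
    hK.exists_isMaxOn hKne continuous_fst.continuousOn
  simp only [Set.mem_ofPred_eq] at hr0 hrM hx hrx
  have hx0 : x ≠ 0 := by
    rintro rfl
    simpa using hx.2
  have key : ∀ t : ℝ, 0 ≤ t → ∀ y : m → ℝ, (∀ i, 0 < y i) → (∀ i, t * y i ≤ (A *ᵥ y) i) →
      t ≤ r := by
    intro t ht y hy h
    set s := ∑ i, y i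
    have hs : 0 < s := Finset.sum_pos (fun i _ => hy i) Finset.univ_nonempty
    have hz : s⁻¹ • y ∈ stdSimplex ℝ m := by
      refine ⟨fun i => (mul_pos (inv_pos.2 hs) (hy i)).le, ?_⟩
      simp only [Pi.smul_apply, smul_eq_mul, ← Finset.mul_sum]
      exact inv_mul_cancel₀ hs.ne'
    have hz' : ∀ i, t * (s⁻¹ • y) i ≤ (A *ᵥ (s⁻¹ • y)) i := fun i => by
      rw [Matrix.mulVec_smul]
      simp only [Pi.smul_apply, smul_eq_mul]
      have := mul_le_mul_of_nonneg_left (h i) (inv_pos.2 hs).le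
      linarith
    refine hmax (⟨⟨⟨ht, ?_⟩, hz⟩, hz'⟩ : (t, s⁻¹ • y) ∈ K)
    calc t = ∑ i, t * (s⁻¹ • y) i := by rw [← Finset.mul_sum, hz.2, mul_one]
      _ ≤ ∑ i, (A *ᵥ (s⁻¹ • y)) i := Finset.sum_le_sum fun i _ => hz' i
      _ ≤ M := Finset.sum_le_sum fun i _ => Finset.sum_le_sum fun j _ =>
          mul_le_of_le_one_right (hA i j) (hz.2 ▸ Finset.single_le_sum
            (fun k _ => hz.1 k) (Finset.mem_univ j))
  set y := ((1 + A) ^ N) *ᵥ x with hy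
  have hypos := hN x hx.1 hx0
  have hcomm : ((1 + A) ^ N) *ᵥ (A *ᵥ x - r • x) = A *ᵥ y - r • y := by
    have : Commute ((1 + A) ^ N) A := ((Commute.one_left A).add_left (Commute.refl A)).pow_left N
    rw [Matrix.mulVec_sub, Matrix.mulVec_smul, Matrix.mulVec_mulVec, this.eq,
      ← Matrix.mulVec_mulVec]
  -- Otherwise (1 + A)^N turns the nonzero nonnegative defect A x - r x into a positive vector. Then
  -- A y > r y in every coordinate, so y has a quotient above the maximum r.
  have heq : A *ᵥ x = r • x := by
    by_contra hne
    have hpos := hN (A *ᵥ x - r • x) (fun i => by simpa using hrx i) (sub_ne_zero.2 hne)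
    rw [hcomm] at hpos
    obtain ⟨k, hk⟩ := Finite.exists_min fun i => (A *ᵥ y) i / y i
    have hk' : r < (A *ᵥ y) k / y k := by
      rw [lt_div_iff₀ (hypos k)]
      simpa using hpos k
    exact hk'.not_ge (key _ (hr0.trans hk'.le) y hypos fun i => (le_div_iff₀ (hypos i)).1 (hk i))
  exact ⟨r, x, hr0, pos_of_mulVec_le hA hirr hx.1 hx0 fun i => (congrFun heq i).le, heq⟩

/-- Right and left Perron vectors. -/
lemma exists_perron_vectors [Nonempty m] {A : Matrix m m ℝ} (hA : ∀ i j, 0 ≤ A i j)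
    (hirr : HasNoClosedSet A) :
    ∃ (r : ℝ) (x w : m → ℝ), 0 ≤ r ∧ (∀ i, 0 < x i) ∧ (∀ i, 0 < w i) ∧ A *ᵥ x = r • x ∧
      w ᵥ* A = r • w := by
  obtain ⟨r, x, hr, hx, hrx⟩ := exists_perron_vector hA hirr
  obtain ⟨s, w, hs, hw, hsw⟩ := exists_perron_vector (A := Aᵀ) (fun i j => hA j i) hirr.transpose
  rw [Matrix.mulVec_transpose] at hsw
  have h := Matrix.dotProduct_mulVec w A x
  have hpos : 0 < w ⬝ᵥ x := Finset.sum_pos (fun i _ => mul_pos (hw i) (hx i)) Finset.univ_nonempty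
  rw [hrx, hsw, dotProduct_smul, smul_dotProduct] at h
  obtain rfl : r = s := mul_right_cancel₀ hpos.ne' h
  exact ⟨r, x, w, hr, hx, hw, hrx, hsw⟩

lemma abs_mul_abs_le_mulVec_abs {A : Matrix m m ℝ} (hA : ∀ i j, 0 ≤ A i j) {μ : ℝ} {y : m → ℝ}
    (hy : A *ᵥ y = μ • y) (i : m) : |μ| * |y i| ≤ (A *ᵥ |y|) i := by
  have h : (A *ᵥ y) i = μ * y i := congrFun hy i
  rw [← abs_mul, ← h]
  refine (Finset.abs_sum_le_sum_abs _ _).trans (Finset.sum_le_sum fun j _ => ?_)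
  rw [abs_mul, abs_of_nonneg (hA i j)]
  rfl

/-- Pair |μ| |y| ≤ A |y| with the positive left vector w, for which w A = r w. -/
lemma abs_le_of_left_vector {A : Matrix m m ℝ} (hA : ∀ i j, 0 ≤ A i j) {r : ℝ} {w : m → ℝ}
    (hw : ∀ i, 0 < w i) (hrw : w ᵥ* A = r • w) {μ : ℝ} {y : m → ℝ} (hy : A *ᵥ y = μ • y)
    (hy0 : y ≠ 0) : |μ| ≤ r := by
  obtain ⟨k, hk⟩ := Function.ne_iff.1 hy0
  have h := Matrix.dotProduct_mulVec w A |y|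
  rw [hrw, smul_dotProduct] at h
  have hpos : 0 < w ⬝ᵥ |y| := Finset.sum_pos'
    (fun i _ => mul_nonneg (hw i).le (abs_nonneg (y i)))
    ⟨k, Finset.mem_univ k, mul_pos (hw k) (abs_pos.2 hk)⟩
  have hle : |μ| * (w ⬝ᵥ |y|) ≤ w ⬝ᵥ (A *ᵥ |y|) := by
    rw [← smul_eq_mul, ← dotProduct_smul]
    exact Finset.sum_le_sum fun i _ =>
      mul_le_mul_of_nonneg_left (abs_mul_abs_le_mulVec_abs hA hy i) (hw i).le
  rw [h] at hle
  exact le_of_mul_le_mul_right hle hpos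

/-- The defect A |y| - r |y| is nonnegative and pairs to zero with the positive w, so it vanishes.
-/
lemma mulVec_abs_eq_of_left_vector {A : Matrix m m ℝ} (hA : ∀ i j, 0 ≤ A i j) {r : ℝ} {w : m → ℝ}
    (hw : ∀ i, 0 < w i) (hrw : w ᵥ* A = r • w) {μ : ℝ} {y : m → ℝ} (hy : A *ᵥ y = μ • y)
    (hμ : |μ| = r) : A *ᵥ |y| = r • |y| := by
  have h := Matrix.dotProduct_mulVec w A |y|
  rw [hrw, smul_dotProduct, ← dotProduct_smul, ← sub_eq_zero, ← dotProduct_sub] at h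
  have h2 := (Finset.sum_eq_zero_iff_of_nonneg fun i _ => mul_nonneg (hw i).le
    (by simpa [hμ] using abs_mul_abs_le_mulVec_abs hA hy i :
      0 ≤ (A *ᵥ |y| - r • |y|) i)).1 h
  ext i
  have := (mul_eq_zero.1 (h2 i (Finset.mem_univ i))).resolve_left (hw i).ne'
  exact sub_eq_zero.1 this

lemma ne_zero_of_extremal_eigenvector {A : Matrix m m ℝ} (hA : ∀ i j, 0 ≤ A i j)
    (hirr : HasNoClosedSet A) {r : ℝ} {w : m → ℝ}
    (hw : ∀ i, 0 < w i) (hrw : w ᵥ* A = r • w) {μ : ℝ} {y : m → ℝ} (hy : A *ᵥ y = μ • y)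
    (hμ : |μ| = r) (hy0 : y ≠ 0) (i : m) : y i ≠ 0 := by
  have h := mulVec_abs_eq_of_left_vector hA hw hrw hy hμ
  refine abs_pos.1 (pos_of_mulVec_le hA hirr (x := |y|) (fun i => abs_nonneg (y i)) ?_
    (fun i => (congrFun h i).le) i)
  simpa using hy0

/-- If the Perron root and its negative are both eigenvalues, the diagonal vanishes. -/
lemma trace_eq_zero_of_neg_eigenvector {A : Matrix m m ℝ} (hA : ∀ i j, 0 ≤ A i j)
    (hirr : HasNoClosedSet A) {r : ℝ} (hr : 0 ≤ r) {w : m → ℝ}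
    (hw : ∀ i, 0 < w i) (hrw : w ᵥ* A = r • w) {y : m → ℝ} (hy : A *ᵥ y = (-r) • y)
    (hy0 : y ≠ 0) : A.trace = 0 := by
  have hμ : |-r| = r := by rw [abs_neg, abs_of_nonneg hr]
  have h := mulVec_abs_eq_of_left_vector hA hw hrw hy hμ
  refine Finset.sum_eq_zero fun i _ => ?_
  have hi := ne_zero_of_extremal_eigenvector hA hirr hw hrw hy hμ hy0 i
  have h1 : ∑ j, A i j * |y j| = r * |y i| := congrFun h i
  have h2 : ∑ j, A i j * y j = -r * y i := congrFun hy i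
  -- With s the sign of y i, row i of the equations for |y| and s y adds up to zero. All terms are
  -- nonnegative, and the diagonal one is 2 A i i |y i|.
  obtain ⟨s, hs, hsi⟩ : ∃ s : ℝ, |s| = 1 ∧ s * y i = |y i| := by
    rcases abs_choice (y i) with h | h
    · exact ⟨1, by simp, by rw [h, one_mul]⟩
    · exact ⟨-1, by simp, by rw [h]; ring⟩
  have h3 : ∑ j, A i j * (|y j| + s * y j) = 0 := by
    have : ∀ j, A i j * (|y j| + s * y j) = A i j * |y j| + s * (A i j * y j) := fun j => by ring
    simp only [this, Finset.sum_add_distrib, ← Finset.mul_sum, h1, h2]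
    linear_combination -r * hsi
  have h4 := (Finset.sum_eq_zero_iff_of_nonneg fun j _ => mul_nonneg (hA i j) (by
    have := neg_abs_le (s * y j)
    rw [abs_mul, hs, one_mul] at this
    linarith)).1 h3 i (Finset.mem_univ i)
  rw [hsi] at h4
  exact (mul_eq_zero.1 h4).resolve_right (by have := abs_pos.2 hi; positivity)

/-- The Perron root is an algebraically simple eigenvalue. -/
lemma rootMultiplicity_charpoly_perron [DecidableEq m] [Nonempty m] {A : Matrix m m ℝ} (hA : ∀ i j, 0 ≤ A i j)
    (hirr : HasNoClosedSet A) {r : ℝ} (hr : 0 ≤ r) {x w : m → ℝ}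
    (hx : ∀ i, 0 < x i) (hw : ∀ i, 0 < w i) (hrx : A *ᵥ x = r • x) (hrw : w ᵥ* A = r • w) :
    A.charpoly.rootMultiplicity r = 1 := by
  obtain ⟨i₀⟩ := ‹Nonempty m›
  have hx0 : x ≠ 0 := fun h => (hx i₀).ne' (congrFun h i₀)
  -- Subtracting y from the multiple of x that agrees with it at i₀ leaves an r-eigenvector with a
  -- zero coordinate, which must be zero.
  have hgeom : ∀ y, A *ᵥ y = r • y → ∃ c : ℝ, c • x = y := by
    intro y hy
    refine ⟨y i₀ / x i₀, ?_⟩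
    by_contra hne
    refine ne_zero_of_extremal_eigenvector hA hirr hw hrw
      (y := (y i₀ / x i₀) • x - y) (μ := r) ?_ (abs_of_nonneg hr) (sub_ne_zero.2 hne) i₀ ?_
    · rw [Matrix.mulVec_sub, Matrix.mulVec_smul, hrx, hy, smul_sub, smul_comm]
    · simp [(hx i₀).ne']
  have hpos : 0 < w ⬝ᵥ x := Finset.sum_pos (fun i _ => mul_pos (hw i) (hx i)) ⟨i₀, Finset.mem_univ _⟩
  set f : Module.End ℝ (m → ℝ) := A.toLin'
  have hsub : ∀ y, (f - algebraMap ℝ (Module.End ℝ (m → ℝ)) r) y = A *ᵥ y - r • y := fun y => by simp [f]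
  -- No Jordan chain: w annihilates the image of A - r, while w · x > 0, so no nonzero multiple of x
  -- lies in that image.
  have hstep : ∀ y, (f - algebraMap ℝ (Module.End ℝ (m → ℝ)) r) ((f - algebraMap ℝ (Module.End ℝ (m → ℝ)) r) y) = 0 →
      (f - algebraMap ℝ (Module.End ℝ (m → ℝ)) r) y = 0 := by
    intro y hy
    rw [hsub, sub_eq_zero] at hy
    obtain ⟨c, hc⟩ := hgeom _ hy
    have h := congrArg (fun z => w ⬝ᵥ z) hc
    simp only [hsub, dotProduct_sub, dotProduct_smul, Matrix.dotProduct_mulVec, hrw,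
      smul_dotProduct, sub_self, smul_eq_mul, mul_eq_zero, hpos.ne', or_false] at h
    rw [← hc, h, zero_smul]
  have hgen : ∀ (k : ℕ) (y : m → ℝ), ((f - algebraMap ℝ (Module.End ℝ (m → ℝ)) r) ^ (k + 1)) y = 0 →
      (f - algebraMap ℝ (Module.End ℝ (m → ℝ)) r) y = 0 := by
    intro k
    induction k with
    | zero => intro y hy; simpa using hy
    | succ k ih =>
      intro y hy
      rw [pow_succ, Module.End.mul_apply] at hy
      exact hstep y (ih _ hy)
  have hspan : f.maxGenEigenspace r = Submodule.span ℝ {x} := by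
    ext y
    rw [Module.End.mem_maxGenEigenspace, Submodule.mem_span_singleton]
    constructor
    · rintro ⟨k, hk⟩
      have hk' : ((f - algebraMap ℝ (Module.End ℝ (m → ℝ)) r) ^ (k + 1)) y = 0 := by
        rw [pow_succ', Module.End.mul_apply]
        simpa [Algebra.algebraMap_eq_smul_one] using
          congrArg (f - algebraMap ℝ (Module.End ℝ (m → ℝ)) r) hk
      have := hgen k y hk'
      rw [hsub, sub_eq_zero] at this
      exact hgeom y this
    · rintro ⟨c, rfl⟩
      refine ⟨1, ?_⟩
      simp [f, hrx]
  have := LinearMap.finrank_maxGenEigenspace_eq f r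
  rw [hspan, finrank_span_singleton hx0] at this
  rw [this, Matrix.charpoly_toLin']

end PerronFrobenius

/-! ### Spectrum as a multiset of complex roots -/

section Spectrum

variable {n : ℕ} {A : Matrix (Fin n) (Fin n) ℝ}

lemma matrixSpectrum_eq_roots (A : Matrix (Fin n) (Fin n) ℝ) :
    matrixSpectrum A = (A.charpoly.map (algebraMap ℝ ℂ)).roots := by
  rw [matrixSpectrum, Matrix.charpoly_map]

lemma count_matrixSpectrum (A : Matrix (Fin n) (Fin n) ℝ) (μ : ℝ) :
    (matrixSpectrum A).count (μ : ℂ) = A.charpoly.rootMultiplicity μ := by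
  rw [matrixSpectrum_eq_roots, count_roots]
  exact (eq_rootMultiplicity_map (algebraMap ℝ ℂ).injective μ).symm

lemma exists_mulVec_eq_smul_of_mem_matrixSpectrum {μ : ℝ} (h : (μ : ℂ) ∈ matrixSpectrum A) :
    ∃ y : Fin n → ℝ, y ≠ 0 ∧ A *ᵥ y = μ • y := by
  rw [← Multiset.one_le_count_iff_mem, count_matrixSpectrum] at h
  have hroot : A.toLin'.charpoly.IsRoot μ := by
    rw [Matrix.charpoly_toLin']
    exact (rootMultiplicity_pos A.charpoly_monic.ne_zero).1 h
  obtain ⟨y, hy⟩ := ((Module.End.hasEigenvalue_iff_isRoot_charpoly _ μ).2 hroot).exists_hasEigenvector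
  exact ⟨y, hy.2, by simpa using hy.apply_eq_smul⟩

lemma sum_matrixSpectrum (A : Matrix (Fin n) (Fin n) ℝ) :
    (matrixSpectrum A).sum = (A.trace : ℂ) := by
  rw [matrixSpectrum, ← Matrix.trace_eq_sum_roots_charpoly]
  simp [Matrix.trace]

lemma card_matrixSpectrum (A : Matrix (Fin n) (Fin n) ℝ) : (matrixSpectrum A).card = n := by
  rw [matrixSpectrum, splits_iff_card_roots.1 (IsAlgClosed.splits _),
    Matrix.charpoly_natDegree_eq_dim, Fintype.card_fin]

lemma matrixSpectrum_of_eval_charpoly {A : Matrix (Fin 4) (Fin 4) ℝ} {a b c d : ℝ}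
    (h : ∀ t : ℝ, (scalar (Fin 4) t - A).det = (t - a) * (t - b) * (t - c) * (t - d)) :
    matrixSpectrum A = {(a : ℂ), (b : ℂ), (c : ℂ), (d : ℂ)} := by
  have hp : A.charpoly = (({a, b, c, d} : Multiset ℝ).map fun z => X - C z).prod := by
    refine Polynomial.funext fun t => ?_
    rw [Matrix.eval_charpoly, h]
    simp [mul_assoc]
  have hq : A.charpoly.map (algebraMap ℝ ℂ) =
      (({(a : ℂ), (b : ℂ), (c : ℂ), (d : ℂ)} : Multiset ℂ).map fun z => X - C z).prod := by
    rw [hp]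
    simp
  rw [matrixSpectrum_eq_roots, hq, roots_multiset_prod_X_sub_C]

end Spectrum

/-! ### Perron root of a real spectrum -/

section PerronRoot

variable {σ : Multiset ℂ}

lemma perronRoot_nonneg (σ : Multiset ℂ) : 0 ≤ perronRoot σ := NNReal.coe_nonneg _

lemma norm_le_perronRoot {z : ℂ} (hz : z ∈ σ) : ‖z‖ ≤ perronRoot σ :=
  NNReal.coe_le_coe.2 (Multiset.le_sup (Multiset.mem_map_of_mem (fun z => ‖z‖₊) hz))

lemma perronRoot_le {r : ℝ} (hr : 0 ≤ r) (h : ∀ z ∈ σ, ‖z‖ ≤ r) : perronRoot σ ≤ r := by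
  lift r to NNReal using hr
  refine NNReal.coe_le_coe.2 (Multiset.sup_le.2 fun b hb => ?_)
  obtain ⟨z, hz, rfl⟩ := Multiset.mem_map.1 hb
  exact_mod_cast h z hz

lemma exists_ofReal_eq (hreal : ∀ z ∈ σ, z.im = 0) {z : ℂ} (hz : z ∈ σ) :
    ∃ t : ℝ, (t : ℂ) = z :=
  ⟨z.re, Complex.ext rfl (by simp [hreal z hz])⟩

/-- The Perron–Frobenius theorem for an irreducible matrix with real spectrum. -/
lemma perronRoot_of_isIrreduciblyRealizable (hreal : ∀ z ∈ σ, z.im = 0) (h0 : 0 < σ.card)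
    (h : IsIrreduciblyRealizable σ) :
    σ.count (perronRoot σ : ℂ) = 1 ∧ (-(perronRoot σ : ℂ) ∈ σ → σ.sum = 0) := by
  obtain ⟨n, A, hA, hirr, rfl⟩ := h
  rw [card_matrixSpectrum] at h0
  have : Nonempty (Fin n) := ⟨⟨0, h0⟩⟩
  have hirr := hasNoClosedSet_of_not_isReducible hirr
  obtain ⟨r, x, w, hr, hx, hw, hrx, hrw⟩ := exists_perron_vectors hA hirr
  have hcount : (matrixSpectrum A).count (r : ℂ) = 1 := by
    rw [count_matrixSpectrum, rootMultiplicity_charpoly_perron hA hirr hr hx hw hrx hrw]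
  have hρ : perronRoot (matrixSpectrum A) = r := by
    refine le_antisymm (perronRoot_le hr fun z hz => ?_) ?_
    · obtain ⟨t, rfl⟩ := exists_ofReal_eq hreal hz
      obtain ⟨y, hy0, hy⟩ := exists_mulVec_eq_smul_of_mem_matrixSpectrum hz
      simpa using abs_le_of_left_vector hA hw hrw hy hy0
    · simpa [abs_of_nonneg hr] using norm_le_perronRoot
        (Multiset.one_le_count_iff_mem.1 hcount.ge)
  rw [hρ]
  refine ⟨hcount, fun hneg => ?_⟩
  obtain ⟨y, hy0, hy⟩ := exists_mulVec_eq_smul_of_mem_matrixSpectrum (μ := -r) (A := A)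
    (by simpa using hneg)
  rw [sum_matrixSpectrum, trace_eq_zero_of_neg_eigenvector hA hirr hr hw hrw hy hy0,
    Complex.ofReal_zero]

end PerronRoot

/-! ### Explicit irreducible realizations -/

section Constructions

/-- Gluing two symmetric `2 × 2` blocks along their Perron vectors. -/
lemma isIrreduciblyRealizable_of_lt {a b c d : ℝ} (hb : |b| < a) (hc : |c| < a) (hd : |d| < a)
    (hcb : c ≤ b) (hdb : d ≤ b) (hsum : 0 ≤ a + b + c + d) :
    IsIrreduciblyRealizable {(a : ℂ), (b : ℂ), (c : ℂ), (d : ℂ)} := by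
  rw [abs_lt] at hb hc hd
  -- The blocks have eigenvalues u, d and v, c with v = a + b - u. The last two bounds make their
  -- diagonals nonnegative; the first two make e positive.
  obtain ⟨u, hu1, hu2, hu3, hu4⟩ : ∃ u : ℝ, b < u ∧ u < a ∧ -d ≤ u ∧ u ≤ a + b + c := by
    refine ⟨(max b (-d) + min a (a + b + c)) / 2, ?_, ?_, ?_, ?_⟩ <;>
    rcases max_cases b (-d) with ⟨h1, _⟩ | ⟨h1, _⟩ <;>
    rcases min_cases a (a + b + c) with ⟨h2, _⟩ | ⟨h2, _⟩ <;>
    rw [h1, h2] <;> linarith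
  -- On block-constant vectors the matrix acts as [[u, 2e], [1, v]], of trace a + b; this e gives
  -- determinant uv - 2e = ab. The vectors (1, -1) in each block keep the eigenvalues d and c.
  set e := (u - b) * (a - u) / 2 with he
  have he0 : 0 < e := by
    have := mul_pos (sub_pos.2 hu1) (sub_pos.2 hu2)
    positivity
  let A : Matrix (Fin 4) (Fin 4) ℝ :=
    !![(u + d) / 2, (u - d) / 2, e, e;
       (u - d) / 2, (u + d) / 2, e, e;
       1 / 2, 1 / 2, (a + b - u + c) / 2, (a + b - u - c) / 2;
       1 / 2, 1 / 2, (a + b - u - c) / 2, (a + b - u + c) / 2]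
  have hoff : ∀ i j, i ≠ j → 0 < A i j := by
    intro i j hij
    fin_cases i <;> fin_cases j <;> first | exact absurd rfl hij | (simp [A]; try linarith)
  refine ⟨4, A, fun i j => ?_, not_isReducible_of_hasNoClosedSet ?_,
    matrixSpectrum_of_eval_charpoly fun t => ?_⟩
  · rcases eq_or_ne i j with rfl | hij
    · fin_cases i <;> simp [A] <;> linarith
    · exact (hoff i j hij).le
  · rintro S ⟨i, hi⟩ ⟨j, hj⟩
    exact ⟨i, hi, j, hj, (hoff i j fun h => hj (h ▸ hi)).ne'⟩
  · rw [Matrix.det_succ_row_zero]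
    simp [A, Fin.sum_univ_succ, Matrix.det_fin_three, Fin.succAbove, he]
    ring

/-- A weighted `4`-cycle has spectrum `{r, -r, a, -a}`. -/
lemma isIrreduciblyRealizable_symmetric {r a : ℝ} (h : |a| < r) :
    IsIrreduciblyRealizable {(r : ℂ), ((-r : ℝ) : ℂ), (a : ℂ), ((-a : ℝ) : ℂ)} := by
  rw [abs_lt] at h
  -- Chosen so that p + q = r and p - q = a.
  set p := (r + a) / 2 with hp
  set q := (r - a) / 2 with hq
  have hp0 : 0 < p := by linarith
  have hq0 : 0 < q := by linarith
  let A : Matrix (Fin 4) (Fin 4) ℝ := !![0, p, 0, q; p, 0, q, 0; 0, q, 0, p; q, 0, p, 0]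
  refine ⟨4, A, fun i j => ?_, not_isReducible_of_hasNoClosedSet ?_,
    matrixSpectrum_of_eval_charpoly fun t => ?_⟩
  · fin_cases i <;> fin_cases j <;> simp [A, hp0.le, hq0.le]
  · rintro S ⟨i, hi⟩ ⟨j, hj⟩
    by_contra! hS
    have hstep : ∀ k : Fin 4, k ∈ S → k + 1 ∈ S := by
      intro k hk
      by_contra hk'
      have := hS k hk (k + 1) hk'
      fin_cases k <;> simp [A, hp0.ne', hq0.ne'] at this
    have h1 := hstep i hi
    have h2 := hstep _ h1
    have h3 := hstep _ h2
    have hcover : ∀ i j : Fin 4, j = i ∨ j = i + 1 ∨ j = i + 1 + 1 ∨ j = i + 1 + 1 + 1 := by decide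
    rcases hcover i j with rfl | rfl | rfl | rfl <;> exact hj (by assumption)
  · rw [Matrix.det_succ_row_zero]
    simp [A, Fin.sum_univ_succ, Matrix.det_fin_three, Fin.succAbove, hp, hq]
    ring

end Constructions

/-! ### Spectral simplicity and Frobenius structure of real lists -/

variable {σ : Multiset ℂ}

lemma isSpectrallySimple_of_count_eq_one (hreal : ∀ z ∈ σ, z.im = 0)
    (hcount : σ.count (perronRoot σ : ℂ) = 1) (hneg : -(perronRoot σ : ℂ) ∉ σ) :
    IsSpectrallySimple σ := by
  have hf : σ.filter (fun z => ‖z‖ = perronRoot σ) = σ.filter ((perronRoot σ : ℂ) = ·) := by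
    refine Multiset.filter_congr fun z hz => ?_
    obtain ⟨t, rfl⟩ := exists_ofReal_eq hreal hz
    constructor
    · intro h
      rw [Complex.norm_real, Real.norm_eq_abs, abs_eq (perronRoot_nonneg σ)] at h
      rcases h with h | h
      · rw [h]
      · exact absurd (by simpa [h] using hz) hneg
    · intro h
      rw [← h, Complex.norm_real, Real.norm_eq_abs, abs_of_nonneg (perronRoot_nonneg σ)]
  rw [IsSpectrallySimple, hf, Multiset.filter_eq, hcount, Multiset.replicate_one]

/-- A real list of four numbers with sum zero, simple Perron root `ρ` and a further element of
modulus `ρ` has the form `ρ, -ρ, a, -a`. -/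
lemma eq_of_not_isSpectrallySimple (hcard : σ.card = 4) (hreal : ∀ z ∈ σ, z.im = 0)
    (hcount : σ.count (perronRoot σ : ℂ) = 1) (hneg : -(perronRoot σ : ℂ) ∈ σ)
    (hsum : σ.sum = 0) :
    ∃ a : ℝ, |a| < perronRoot σ ∧
      σ = {(perronRoot σ : ℂ), ((-perronRoot σ : ℝ) : ℂ), (a : ℂ), ((-a : ℝ) : ℂ)} := by
  set r := perronRoot σ with hr
  have hle : ∀ z ∈ σ, ‖z‖ ≤ r := fun z hz => norm_le_perronRoot hz
  have hr0 : 0 ≤ r := perronRoot_nonneg σ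
  clear_value r
  obtain ⟨τ, rfl⟩ := Multiset.exists_cons_of_mem (Multiset.one_le_count_iff_mem.1 hcount.ge)
  rw [Multiset.count_cons_self, Nat.add_eq_right, Multiset.count_eq_zero] at hcount
  rw [Multiset.card_cons] at hcard
  have hpos : r ≠ 0 := by
    rintro rfl
    obtain ⟨z, hz⟩ := Multiset.card_pos_iff_exists_mem.1 (by omega : 0 < τ.card)
    have := hle z (Multiset.mem_cons_of_mem hz)
    rw [norm_le_zero_iff] at this
    exact hcount (by simpa [this] using hz)
  have hneg' : -(r : ℂ) ∈ τ := by
    refine (Multiset.mem_cons.1 hneg).resolve_left fun h => hpos ?_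
    have : -r = r := by exact_mod_cast h
    linarith
  obtain ⟨υ, rfl⟩ := Multiset.exists_cons_of_mem hneg'
  obtain ⟨x, y, rfl⟩ := Multiset.card_eq_two.1 (by simpa using hcard : υ.card = 2)
  obtain ⟨a, rfl⟩ := exists_ofReal_eq hreal (z := x) (by simp)
  obtain ⟨b, rfl⟩ := exists_ofReal_eq hreal (z := y) (by simp)
  have hab : b = -a := by
    have : ((a + b : ℝ) : ℂ) = 0 := by simpa using hsum
    have : a + b = 0 := by exact_mod_cast this
    linarith
  subst hab
  refine ⟨a, lt_of_le_of_ne (by simpa using hle a (by simp)) fun h => hcount ?_, ?_⟩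
  · rcases (abs_eq hr0).1 h with h | h <;> simp [h]
  · rw [Complex.ofReal_neg r]
    rfl

lemma hasFrobeniusStructure_symmetric {r a : ℝ} (h : |a| < r)
    (hr : perronRoot {(r : ℂ), ((-r : ℝ) : ℂ), (a : ℂ), ((-a : ℝ) : ℂ)} = r) :
    HasFrobeniusStructure {(r : ℂ), ((-r : ℝ) : ℂ), (a : ℂ), ((-a : ℝ) : ℂ)} := by
  have hpos : 0 < r := (abs_nonneg a).trans_lt h
  refine ⟨by simp, by simp, by rw [hr]; simp, fun hs => ?_, by rwa [hr], ?_⟩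
  · have hmem : ((-r : ℝ) : ℂ) ∈ Multiset.filter (fun z => ‖z‖ = r)
        {(r : ℂ), ((-r : ℝ) : ℂ), (a : ℂ), ((-a : ℝ) : ℂ)} := by
      simp [abs_of_pos hpos]
    rw [IsSpectrallySimple, hr] at hs
    rw [hs, Multiset.mem_singleton] at hmem
    have : -r = r := by exact_mod_cast hmem
    linarith
  · rw [hr]
    -- Frobenius structure forbids z = 0, so for a = 0 the two zero roots go into X ^ p with p = 2.
    rcases eq_or_ne a 0 with rfl | ha
    · refine ⟨2, 2, 0, one_lt_two, by simp, ?_⟩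
      simp
      ring
    · have hrC : (r : ℂ) ≠ 0 := by exact_mod_cast hpos.ne'
      refine ⟨2, 0, {((a / r : ℝ) : ℂ)}, one_lt_two, ?_, ?_⟩
      · simp [ha, hpos.ne', abs_of_pos hpos, div_lt_one hpos, h]
      · rw [Multiset.map_singleton, Multiset.prod_singleton, Complex.ofReal_div,
          div_mul_cancel₀ _ hrC]
        simp
        ring

lemma nextCoeff_X_pow_sub_C {h : ℕ} (hh : 1 < h) (c : ℂ) :
    (X ^ h - C c).nextCoeff = 0 := by
  rw [nextCoeff_of_natDegree_pos (by rw [natDegree_X_pow_sub_C]; omega), natDegree_X_pow_sub_C,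
    coeff_sub, coeff_X_pow, coeff_C, if_neg (by omega), if_neg (by omega), sub_zero]

/-- The next coefficient is minus the sum of the roots and is additive over monic products. It is
zero for each factor because h > 1. -/
lemma sum_eq_zero_of_prod_eq {p h : ℕ} (hh : 1 < h) {c : ℂ} {Z : Multiset ℂ} {f : ℂ → ℂ}
    (hprod : (σ.map (fun z => X - C z)).prod =
      X ^ p * (X ^ h - C c) * (Z.map (fun z => X ^ h - C (f z))).prod) : σ.sum = 0 := by
  have hmon : ∀ c : ℂ, (X ^ h - C c).Monic := fun c => monic_X_pow_sub_C c (by omega)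
  have hZ : ((Z.map (fun z => X ^ h - C (f z))).prod).nextCoeff = 0 := by
    rw [Monic.nextCoeff_multiset_prod _ _ fun z _ => hmon (f z)]
    simp [nextCoeff_X_pow_sub_C hh]
  have hX : (X ^ p : ℂ[X]).nextCoeff = 0 := by
    rw [Monic.nextCoeff_pow monic_X]
    simp [nextCoeff]
  have := congrArg nextCoeff hprod
  rw [multiset_prod_X_sub_C_nextCoeff, Monic.nextCoeff_mul ((monic_X_pow p).mul (hmon c))
    (monic_multiset_prod_of_monic _ _ fun z _ => hmon (f z)),
    Monic.nextCoeff_mul (monic_X_pow p) (hmon c), hX, hZ, nextCoeff_X_pow_sub_C hh] at this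
  simpa using this

/-- A double root would kill the derivative at r, which is h r^(h-1) Q(r). The cofactor Q does not
vanish at r, since z^h = 1 is impossible for |z| < 1. -/
lemma count_eq_one_of_prod_eq {r : ℂ} (hr : r ≠ 0) {p h : ℕ} (hh : 1 < h) {Z : Multiset ℂ}
    (hZ : ∀ z ∈ Z, ‖z‖ < 1)
    (hprod : (σ.map (fun z => X - C z)).prod =
      X ^ p * (X ^ h - C (r ^ h)) * (Z.map (fun z => X ^ h - C ((z * r) ^ h))).prod) :
    σ.count r = 1 := by
  set Q : ℂ[X] := X ^ p * (Z.map (fun z => X ^ h - C ((z * r) ^ h))).prod with hQ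
  have hQr : Q.eval r ≠ 0 := by
    rw [hQ, eval_mul, eval_pow, eval_X, eval_multiset_prod, Multiset.map_map]
    refine mul_ne_zero (pow_ne_zero _ hr) (Multiset.prod_ne_zero fun h0 => ?_)
    obtain ⟨z, hz, hz0⟩ := Multiset.mem_map.1 h0
    simp only [Function.comp_apply, eval_sub, eval_pow, eval_X, eval_C, mul_pow] at hz0
    have h1 : z ^ h = 1 := by
      refine mul_right_cancel₀ (pow_ne_zero h hr) ?_
      linear_combination -hz0
    have h2 := pow_lt_one₀ (norm_nonneg z) (hZ z hz) (by omega : h ≠ 0)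
    rw [← norm_pow, h1, norm_one] at h2
    exact h2.false
  have hfac : (σ.map (fun z => X - C z)).prod = (X ^ h - C (r ^ h)) * Q := by
    rw [hprod, hQ]
    ring
  have hmem : r ∈ σ := by
    have h0 : (σ.map (fun z => X - C z)).prod.IsRoot r := by
      rw [hfac]
      simp [IsRoot]
    rw [← roots_multiset_prod_X_sub_C σ]
    exact (mem_roots (monic_multisetProd_X_sub_C σ).ne_zero).2 h0
  obtain ⟨τ, rfl⟩ := Multiset.exists_cons_of_mem hmem
  rw [Multiset.count_cons_self, Nat.add_eq_right, Multiset.count_eq_zero]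
  intro hτ
  obtain ⟨υ, rfl⟩ := Multiset.exists_cons_of_mem hτ
  have hder := congrArg (fun P : ℂ[X] => (derivative P).eval r) hfac
  simp only [Multiset.map_cons, Multiset.prod_cons, derivative_mul, eval_add, eval_mul, eval_sub,
    eval_X, eval_C, sub_self, zero_mul, mul_zero, eval_pow, derivative_sub, derivative_X_pow,
    derivative_C, sub_zero, add_zero] at hder
  have : (h : ℂ) ≠ 0 := by exact_mod_cast (by omega : h ≠ 0)
  exact mul_ne_zero (mul_ne_zero this (pow_ne_zero _ hr)) hQr hder.symm

lemma isIrreduciblyRealizable_of_hasFrobeniusStructure (hcard : σ.card = 4)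
    (hreal : ∀ z ∈ σ, z.im = 0) (h : HasFrobeniusStructure σ) : IsIrreduciblyRealizable σ := by
  obtain ⟨-, -, -, hns, hpos, k, p, Z, hk, hZ, hprod⟩ := h
  have hcount := count_eq_one_of_prod_eq (by exact_mod_cast hpos.ne') hk (fun z hz => (hZ z hz).2)
    hprod
  have hneg : -(perronRoot σ : ℂ) ∈ σ := by
    by_contra hneg
    exact hns (isSpectrallySimple_of_count_eq_one hreal hcount hneg)
  obtain ⟨a, ha, hσ⟩ := eq_of_not_isSpectrallySimple hcard hreal hcount hneg
    (sum_eq_zero_of_prod_eq hk hprod)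
  rw [hσ]
  exact isIrreduciblyRealizable_symmetric ha

lemma isSpectrallySimple_or_hasFrobeniusStructure (hcard : σ.card = 4)
    (hreal : ∀ z ∈ σ, z.im = 0) (h : IsIrreduciblyRealizable σ) :
    IsSpectrallySimple σ ∨ HasFrobeniusStructure σ := by
  obtain ⟨hcount, htrace⟩ := perronRoot_of_isIrreduciblyRealizable hreal (by omega) h
  by_cases hneg : -(perronRoot σ : ℂ) ∈ σ
  · obtain ⟨a, ha, hσ⟩ := eq_of_not_isSpectrallySimple hcard hreal hcount hneg (htrace hneg)
    right
    have := hasFrobeniusStructure_symmetric ha (congrArg perronRoot hσ.symm)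
    rwa [← hσ] at this
  · exact Or.inl (isSpectrallySimple_of_count_eq_one hreal hcount hneg)

lemma isIrreduciblyRealizable_of_isSpectrallySimple (hcard : σ.card = 4)
    (hreal : ∀ z ∈ σ, z.im = 0) (hsum : 0 ≤ σ.sum.re) (h : IsSpectrallySimple σ) :
    IsIrreduciblyRealizable σ := by
  rw [IsSpectrallySimple] at h
  set r := perronRoot σ with hr
  have hle : ∀ z ∈ σ, ‖z‖ ≤ r := fun z hz => norm_le_perronRoot hz
  have hr0 : 0 ≤ r := perronRoot_nonneg σ
  clear_value r
  have hmem : (r : ℂ) ∈ σ.filter (fun z => ‖z‖ = r) := by simp [h]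
  obtain ⟨τ, rfl⟩ := Multiset.exists_cons_of_mem (Multiset.mem_of_mem_filter hmem)
  rw [Multiset.filter_cons_of_pos _ (by simp [abs_of_nonneg hr0]), ← Multiset.cons_zero,
    Multiset.cons_inj_right, Multiset.filter_eq_nil] at h
  rw [Multiset.card_cons] at hcard
  obtain ⟨x, y, z, rfl⟩ := Multiset.card_eq_three.1 (by omega : τ.card = 3)
  obtain ⟨b, rfl⟩ := exists_ofReal_eq hreal (z := x) (by simp)
  obtain ⟨c, rfl⟩ := exists_ofReal_eq hreal (z := y) (by simp)
  obtain ⟨d, rfl⟩ := exists_ofReal_eq hreal (z := z) (by simp)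
  have hb : |b| < r := lt_of_le_of_ne (by simpa using hle b (by simp)) (by simpa using h b (by simp))
  have hc : |c| < r := lt_of_le_of_ne (by simpa using hle c (by simp)) (by simpa using h c (by simp))
  have hd : |d| < r := lt_of_le_of_ne (by simpa using hle d (by simp)) (by simpa using h d (by simp))
  have hs : 0 ≤ r + b + c + d := by simpa [add_assoc] using hsum
  have hcb : ({(r : ℂ), (c : ℂ), (b : ℂ), (d : ℂ)} : Multiset ℂ) =
      (r : ℂ) ::ₘ {(b : ℂ), (c : ℂ), (d : ℂ)} :=
    congrArg _ (Multiset.cons_swap _ _ _)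
  have hdb : ({(r : ℂ), (d : ℂ), (b : ℂ), (c : ℂ)} : Multiset ℂ) =
      (r : ℂ) ::ₘ {(b : ℂ), (c : ℂ), (d : ℂ)} :=
    congrArg _ ((Multiset.cons_swap _ _ _).trans (congrArg _ (Multiset.pair_comm _ _)))
  -- The gluing construction needs the largest of b, c, d in second position.
  rcases le_total c b with h1 | h1
  · rcases le_total d b with h2 | h2
    · exact isIrreduciblyRealizable_of_lt hb hc hd h1 h2 hs
    · rw [← hdb]
      exact isIrreduciblyRealizable_of_lt hd hb hc h2 (h1.trans h2) (by linarith)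
  · rcases le_total d c with h2 | h2
    · rw [← hcb]
      exact isIrreduciblyRealizable_of_lt hc hb hd h1 h2 (by linarith)
    · rw [← hdb]
      exact isIrreduciblyRealizable_of_lt hd hb hc (h1.trans h2) h2 (by linarith)

lemma IsRealizable.sum_re_nonneg (h : IsRealizable σ) : 0 ≤ σ.sum.re := by
  obtain ⟨n, A, hA, rfl⟩ := h
  rw [sum_matrixSpectrum, Complex.ofReal_re]
  exact Finset.sum_nonneg fun i _ => hA i i

end NIEP

theorem theorem20 (σ : Multiset ℂ) (hcard : σ.card = 4) (hreal : ∀ z ∈ σ, z.im = 0)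
    (hσ : NIEP.IsRealizable σ) :
    Xor (NIEP.IsIrreduciblyRealizable σ)
      (¬ NIEP.IsSpectrallySimple σ ∧ ¬ NIEP.HasFrobeniusStructure σ) := by
  by_cases h : NIEP.IsIrreduciblyRealizable σ
  · refine Or.inl ⟨h, fun hn => ?_⟩
    exact (NIEP.isSpectrallySimple_or_hasFrobeniusStructure hcard hreal h).elim hn.1 hn.2
  · refine Or.inr ⟨⟨fun hs => h ?_, fun hf => h ?_⟩, h⟩
    · exact NIEP.isIrreduciblyRealizable_of_isSpectrallySimple hcard hreal hσ.sum_re_nonneg hs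
    · exact NIEP.isIrreduciblyRealizable_of_hasFrobeniusStructure hcard hreal hf
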